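/- Let $p$ be a prime with $p\equiv 1\pmod 3$, let $\zeta=\zeta_p$ be a primitive $p$-th root of unity, and let $r$ be a primitive root modulo $p$. Let $\sigma$ be the automorphism of $\mathbb{Q}(\zeta)$ with $\sigma(\zeta)=\zeta^r$, and let $\lambda$ be an integer with $\lambda(r-1)\equiv 1\pmod p$. Put $$\alpha=\prod_{j=0}^{(p-3)/2}\bigl(1-\zeta^{r^j}\bigr),\qquad z=\zeta^{\lambda}\alpha(1-\zeta).$$ Let $\mathbb{K}$ be the subfield of $\mathbb{Q}(\zeta)$ fixed by $\sigma^3$, let $x=\mathrm{Tr}_{\mathbb{Q}(\zeta)/\mathbb{K}}(z)\in\mathbb{K}$, and let $$M=\langle x+\sigma(x),\;x-\sigma(x),\;\sigma(x)-\sigma^2(x)\rangle_{\mathbb{Z}}\subset\mathbb{K}.$$ Then $\mathbb{K}$ has degree $3$ over $\mathbb{Q}$ and exactly three embeddings into $\mathbb{R}$ (so it is totally real), $x\neq 0$, and $$N_{\mathbb{K}/\mathbb{Q}}(x+\sigma(x))=-N_{\mathbb{K}/\mathbb{Q}}(x).$$ Let $\sigma_1,\sigma_2,\sigma_3$ be the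 embeddings of $\mathbb{K}$ into $\mathbb{R}$, in any order, let $\beta=1/p^2$, and let $\varphi_\beta:\mathbb{K}\to\mathbb{R}^3$, $\varphi_\beta(y)=\bigl(\sqrt{\sigma_i(\beta)}\,\sigma_i(y)\bigr)_{i=1,2,3}$. Then the lattice $\Lambda=\varphi_\beta(M)$ is a rotated version of $$D_3=\{v\in\mathbb{Z}^3: v_1+v_2+v_3\ \text{is even}\},$$ that is, $\Lambda=A\,D_3$ for some $A\in SO_3(\mathbb{R})$, and $\Lambda$ has maximum diversity: every nonzero $v\in\Lambda$ has all its coordinates nonzero. If moreover $u=\sigma(x)/x$ lies in $\mathbb{Z}[\zeta]$, then the minimum product distance of $\Lambda$ is $$d_{p,\min}(\Lambda)=\inf\{|v_1v_2v_3| : 0\neq v\in\Lambda\}=\frac1p .$$ -/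

import Mathlib

noncomputable section

namespace RotatedDn

open scoped Matrix

/-! ### Lattices in `ℝⁿ` -/

/-- The lattice `D_n`: the integral vectors whose coordinates have an even sum. -/
def Dlat (n : ℕ) : Submodule ℤ (Fin n → ℝ) where
  carrier := {v | ∃ a : Fin n → ℤ, (∀ i, v i = (a i : ℝ)) ∧ ∃ m : ℤ, ∑ i, a i = 2 * m}
  zero_mem' := ⟨0, by simp, 0, by simp⟩
  add_mem' := by
    rintro v w ⟨a, ha, k, hk⟩ ⟨b, hb, l, hl⟩
    refine ⟨a + b, fun i => by simp [ha i, hb i], k + l, ?_⟩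
    simp only [Pi.add_apply, Finset.sum_add_distrib, hk, hl]
    ring
  smul_mem' := by
    rintro c v ⟨a, ha, k, hk⟩
    refine ⟨c • a, fun i => by simp [ha i], c * k, ?_⟩
    simp only [Pi.smul_apply, smul_eq_mul, ← Finset.mul_sum, hk]
    ring

/-- `Λ₁` is a rotated version of `Λ₂`: it is the image of `Λ₂` under an orthogonal matrix of
determinant one. -/
def IsRotatedVersion {n : ℕ} (Λ₁ Λ₂ : Submodule ℤ (Fin n → ℝ)) : Prop :=
  ∃ A ∈ Matrix.specialOrthogonalGroup (Fin n) ℝ,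
    (Λ₁ : Set (Fin n → ℝ)) = (fun v => A *ᵥ v) '' (Λ₂ : Set (Fin n → ℝ))

/-- Maximum diversity: no nonzero vector of the lattice has a zero coordinate. -/
def HasMaximumDiversity {n : ℕ} (Λ : Submodule ℤ (Fin n → ℝ)) : Prop :=
  ∀ v ∈ Λ, v ≠ 0 → ∀ i, v i ≠ 0

/-- The minimum product distance `inf {|v₁ ⋯ v_n| : 0 ≠ v ∈ Λ}`. -/
def minProductDistance {n : ℕ} (Λ : Submodule ℤ (Fin n → ℝ)) : ℝ :=
  sInf {d : ℝ | ∃ v ∈ Λ, v ≠ 0 ∧ d = |∏ i, v i|}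

/-- The twisted homomorphism `y ↦ (√(e₁ β) e₁ y, …, √(e_n β) e_n y)` of a field `F` whose
embeddings into `ℝ` are `e₁, …, e_n`. -/
def twistedHom {F : Type*} [Field F] {n : ℕ} (e : Fin n ≃ (F →+* ℝ)) (β : F) :
    F →ₗ[ℤ] (Fin n → ℝ) where
  toFun y i := √(e i β) * e i y
  map_add' y w := by
    ext i
    simp [mul_add]
  map_smul' c y := by
    ext i
    simp
    ring

/-! ### The cyclic field `K ⊆ ℚ(ζ_p)` of degree `n` and the `ℤ`-module `M` -/

variable {L : Type*} [Field L] [CharZero L]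

/-- The fixed field `K` of the group generated by `σⁿ`. -/
def fixedK (σ : L ≃ₐ[ℚ] L) (n : ℕ) : IntermediateField ℚ L :=
  IntermediateField.fixedField (Subgroup.zpowers (σ ^ n))

theorem map_mem_fixedK (σ : L ≃ₐ[ℚ] L) (n : ℕ) {y : L} (hy : y ∈ fixedK σ n) :
    σ y ∈ fixedK σ n := by
  rw [fixedK, IntermediateField.mem_fixedField_iff] at hy ⊢
  rintro f ⟨k, rfl⟩
  have hc : (σ ^ n) ^ k * σ = σ * (σ ^ n) ^ k :=
    (((Commute.refl σ).pow_left n).zpow_left k).eq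
  have h1 := hy _ ⟨k, rfl⟩
  change ((σ ^ n) ^ k * σ) y = σ y
  rw [hc]
  exact congrArg σ h1

/-- The restriction of `σ` to `K`. -/
def sigmaK (σ : L ≃ₐ[ℚ] L) (n : ℕ) : fixedK σ n →ₐ[ℚ] fixedK σ n :=
  (σ.toAlgHom.comp (fixedK σ n).val).codRestrict (fixedK σ n).toSubalgebra
    (fun y => map_mem_fixedK σ n y.2)

/-- `α = ∏_{j=0}^{(p-1)/2-1} (1 - ζ^(r^j))`. -/
def alphaElt (p r : ℕ) (ζ : L) : L :=
  ∏ j ∈ Finset.range ((p - 1) / 2), (1 - ζ ^ (r ^ j))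

/-- `z = ζ^l α (1 - ζ)`. -/
def zElt (p r : ℕ) (l : ℤ) (ζ : L) : L :=
  ζ ^ l * alphaElt p r ζ * (1 - ζ)

/-- `x = Tr_{ℚ(ζ_p)/K}(z)`. -/
def xElt (n p r : ℕ) (l : ℤ) (ζ : L) (σ : L ≃ₐ[ℚ] L) : fixedK σ n :=
  Algebra.trace (fixedK σ n) L (zElt p r l ζ)

/-- For `y ∈ K`, the `ℤ`-module generated by `y + σ(y)` and by `σ^i(y) - σ^(i+1)(y)`,
`0 ≤ i ≤ n - 2`. -/
def moduleM (σ : L ≃ₐ[ℚ] L) (n : ℕ) (y : fixedK σ n) : Submodule ℤ (fixedK σ n) :=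
  Submodule.span ℤ
    ({y + sigmaK σ n y} ∪
      {w | ∃ i : ℕ, i + 1 < n ∧ w = (sigmaK σ n ^ i) y - (sigmaK σ n ^ (i + 1)) y})

/-- The algebraic lattice `φ_β(M) ⊆ ℝⁿ` with `β = 1 / p²`, where `M` is the module attached to
the element `x`. -/
def latticeD (n p r : ℕ) (l : ℤ) (ζ : L) (σ : L ≃ₐ[ℚ] L) (e : Fin n ≃ (fixedK σ n →+* ℝ)) :
    Submodule ℤ (Fin n → ℝ) :=
  (moduleM σ n (xElt n p r l ζ σ)).map (twistedHom e (1 / (p : fixedK σ n) ^ 2))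

end RotatedDn

end

noncomputable section

namespace RotatedDn

open scoped Matrix

/-! ### Cubic fields with an automorphism of order three -/

/-! Write τ for the restriction of σ to K and p = 6k + 1. Everything rests on two identities for x:
the squares of x, τx, τ²x sum to p², and their pairwise products sum to 0
(`orthogonal_conjugates_xElt`). So the matrix with entries e_i(τ^j x)/p is orthogonal; since M
consists of the integer combinations of the conjugates of x with even coefficient sum, it carries
D_3 onto Λ.

The identities come from w = ζ^l α, for which σ(w) = -w and w² = ±p. The conjugates of z are thus
±w(1 - ζ^a), and the correlations of z with its conjugates are sums of roots of unity. Summing these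
over cosets of ⟨σ³⟩ with alternating signs cancels all but the contribution of complex conjugation
σ^(3k).

For the product distance, w divides x, which forces p² ∣ N(x). If u is integral, N(x) divides p³,
and the sum of squares rules out |N(x)| = p³. Every element of M is then x times an algebraic
integer, so its norm is at least p² in absolute value; x + τx attains this, and scaling by p⁻³ gives
1/p. -/

/-- A number field of odd degree has a real embedding. -/
theorem nonempty_real_embedding_of_odd_finrank (K : Type*) [Field K] [NumberField K]
    (h : Odd (Module.finrank ℚ K)) : Nonempty (K →+* ℝ) := by
  classical
  have h1 := NumberField.InfinitePlace.card_add_two_mul_card_eq_rank K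
  have h2 : 0 < NumberField.InfinitePlace.nrRealPlaces K := by
    rcases h with ⟨k, hk⟩
    omega
  obtain ⟨w⟩ := Fintype.card_pos_iff.mp h2
  exact ⟨NumberField.InfinitePlace.embedding_of_isReal w.2⟩

section Cubic

variable {K : Type*} [Field K] [Algebra ℚ K] {τ : K →ₐ[ℚ] K} {x : K} {p : ℕ}

/-- If τx = x, the two relations become 3x² = p² and 3x² = 0, which is absurd. -/
theorem ne_of_orthogonal_conjugates [CharZero K] (hp : p ≠ 0) (hτ : ∀ y, τ (τ (τ y)) = y)
    (hP : x ^ 2 + τ x ^ 2 + τ (τ x) ^ 2 = (p : K) ^ 2)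
    (hQ : x * τ x + τ x * τ (τ x) + τ (τ x) * x = 0) :
    x ≠ 0 ∧ τ x ≠ x ∧ τ (τ x) ≠ x := by
  have hp' : (p : K) ^ 2 ≠ 0 := by positivity
  have key : τ x ≠ x := by
    intro h
    rw [h, h] at hP hQ
    apply hp'
    linear_combination -hP + hQ
  refine ⟨?_, key, ?_⟩
  · rintro rfl
    exact key (by simp)
  · intro h
    apply key
    have := congrArg τ h
    rw [hτ] at this
    exact this.symm

/-- The three composites differ at x, and a cubic field has at most three embeddings. -/
theorem bijective_comp_pow_real [FiniteDimensional ℚ K] (hK : Module.finrank ℚ K = 3)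
    (h1 : τ x ≠ x) (h2 : τ (τ x) ≠ x) (f : K →+* ℝ) :
    Function.Bijective (fun t : Fin 3 => f.comp ((τ ^ (t : ℕ)) : K →ₐ[ℚ] K).toRingHom) := by
  have h3 : τ (τ x) ≠ τ x := fun h => h1 (τ.injective h)
  have hcard : Nat.card (K →+* ℝ) ≤ 3 := by
    rw [Nat.card_congr (RingHom.equivRatAlgHom K ℝ), ← hK]
    exact card_algHom_le_finrank ℚ K ℝ
  have : Finite (K →+* ℝ) := Finite.of_equiv _ (RingHom.equivRatAlgHom K ℝ).symm
  refine Function.Injective.bijective_of_nat_card_le ?_ (by simpa using hcard)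
  intro s t hst
  have h := f.injective (RingHom.congr_fun hst x)
  fin_cases s <;> fin_cases t <;> first | rfl | (exfalso; simp [pow_succ] at h; tauto)

theorem norm_eq_mul_conjugates [FiniteDimensional ℚ K] (hK : Module.finrank ℚ K = 3)
    (hτ : ∀ y, τ (τ (τ y)) = y) (h1 : τ x ≠ x) (h2 : τ (τ x) ≠ x) (y : K) :
    algebraMap ℚ K (Algebra.norm ℚ y) = y * τ y * τ (τ y) := by
  have h3 : τ (τ x) ≠ τ x := fun h => h1 (τ.injective h)
  let g : K ≃ₐ[ℚ] K := AlgEquiv.ofAlgHom τ (τ.comp τ)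
    (AlgHom.ext fun y => hτ y) (AlgHom.ext fun y => hτ y)
  have hg : ∀ y, g y = τ y := fun y => rfl
  have hinj : Function.Injective (fun t : Fin 3 => g ^ (t : ℕ)) := by
    intro s t hst
    have h := DFunLike.congr_fun hst x
    fin_cases s <;> fin_cases t <;>
      first | rfl | (exfalso; simp [pow_succ, hg] at h; tauto)
  have hle : Fintype.card (K ≃ₐ[ℚ] K) ≤ 3 := hK ▸ AlgEquiv.card_le
  have hbij := hinj.bijective_of_nat_card_le (by simpa using hle)
  have hgal : IsGalois ℚ K := by
    apply IsGalois.of_card_aut_eq_finrank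
    rw [hK, ← Nat.card_congr (Equiv.ofBijective _ hbij)]
    simp
  rw [Algebra.norm_eq_prod_automorphisms, ← hbij.prod_comp fun g => g y, Fin.prod_univ_three]
  simp [pow_succ, hg]

theorem prod_embeddings_eq_norm [FiniteDimensional ℚ K] (hK : Module.finrank ℚ K = 3)
    (hτ : ∀ y, τ (τ (τ y)) = y) (h1 : τ x ≠ x) (h2 : τ (τ x) ≠ x)
    (e : Fin 3 ≃ (K →+* ℝ)) (y : K) :
    ∏ i, e i y = (Algebra.norm ℚ y : ℝ) := by
  have hb := bijective_comp_pow_real hK h1 h2 (e 0)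
  have : Fintype (K →+* ℝ) := Fintype.ofEquiv _ e
  rw [Equiv.prod_comp e (fun f => f y), ← hb.prod_comp fun f => f y, Fin.prod_univ_three]
  have h := congrArg (e 0) (norm_eq_mul_conjugates hK hτ h1 h2 y)
  rw [eq_ratCast, map_ratCast, map_mul, map_mul] at h
  rw [h]
  simp [pow_succ]

theorem norm_add_conjugate [CharZero K] [FiniteDimensional ℚ K] (hp : p ≠ 0)
    (hK : Module.finrank ℚ K = 3)
    (hτ : ∀ y, τ (τ (τ y)) = y)
    (hP : x ^ 2 + τ x ^ 2 + τ (τ x) ^ 2 = (p : K) ^ 2)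
    (hQ : x * τ x + τ x * τ (τ x) + τ (τ x) * x = 0) :
    Algebra.norm ℚ (x + τ x) = -Algebra.norm ℚ x := by
  obtain ⟨-, h1, h2⟩ := ne_of_orthogonal_conjugates hp hτ hP hQ
  apply (algebraMap ℚ K).injective
  rw [map_neg, norm_eq_mul_conjugates hK hτ h1 h2, norm_eq_mul_conjugates hK hτ h1 h2]
  simp only [map_add, hτ]
  -- With elementary symmetric functions, (a+b)(b+c)(c+a) = e₁e₂ - e₃, and e₂ = 0.
  linear_combination (x + τ x + τ (τ x)) * hQ

theorem sum_mul_conjugates_eq (f : K →+* ℝ)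
    (hP : x ^ 2 + τ x ^ 2 + τ (τ x) ^ 2 = (p : K) ^ 2) :
    f x ^ 2 + f (τ x) ^ 2 + f (τ (τ x)) ^ 2 = (p : ℝ) ^ 2 := by
  simpa using congrArg f hP

/-- The matrix whose columns are the images under `twistedHom` of the conjugates of `x`. -/
def conjugateMatrix (τ : K →ₐ[ℚ] K) (x : K) (p : ℕ) (e : Fin 3 ≃ (K →+* ℝ)) :
    Matrix (Fin 3) (Fin 3) ℝ :=
  Matrix.of fun i j => (p : ℝ)⁻¹ * e i ((τ ^ (j : ℕ)) x)

omit [Algebra ℚ K] in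
theorem twistedHom_apply_one_div_sq (e : Fin 3 ≃ (K →+* ℝ)) (y : K) (i : Fin 3) :
    twistedHom e (1 / (p : K) ^ 2) y i = (p : ℝ)⁻¹ * e i y := by
  simp [twistedHom]

/-- Any two embeddings differ by a power of τ, so the inner product of two rows is p⁻² times the
image of one of the two relations. -/
theorem conjugateMatrix_mem_orthogonalGroup [CharZero K] [FiniteDimensional ℚ K] (hp : p ≠ 0)
    (hK : Module.finrank ℚ K = 3) (hτ : ∀ y, τ (τ (τ y)) = y)
    (hP : x ^ 2 + τ x ^ 2 + τ (τ x) ^ 2 = (p : K) ^ 2)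
    (hQ : x * τ x + τ x * τ (τ x) + τ (τ x) * x = 0) (e : Fin 3 ≃ (K →+* ℝ)) :
    conjugateMatrix τ x p e ∈ Matrix.orthogonalGroup (Fin 3) ℝ := by
  obtain ⟨-, h1, h2⟩ := ne_of_orthogonal_conjugates hp hτ hP hQ
  have hp' : (p : ℝ) ≠ 0 := by positivity
  rw [Matrix.mem_orthogonalGroup_iff]
  ext i k
  have hQ' : e i x * e i (τ x) + e i (τ x) * e i (τ (τ x)) + e i (τ (τ x)) * e i x = 0 := by
    simpa using congrArg (e i) hQ
  rw [Matrix.mul_apply, Fin.sum_univ_three]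
  simp only [Matrix.transpose_apply, conjugateMatrix, Matrix.of_apply, Fin.val_zero, Fin.val_one,
    Fin.val_two, pow_succ, pow_zero, one_mul, AlgHom.mul_apply, AlgHom.one_apply]
  by_cases hik : i = k
  · subst hik
    rw [Matrix.one_apply_eq]
    have := sum_mul_conjugates_eq (e i) hP
    field_simp
    linear_combination this
  · rw [Matrix.one_apply_ne hik]
    obtain ⟨t, ht⟩ := (bijective_comp_pow_real hK h1 h2 (e i)).2 (e k)
    have ht' : ∀ y, e k y = e i ((τ ^ (t : ℕ)) y) := fun y => (RingHom.congr_fun ht y).symm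
    simp only [ht']
    fin_cases t
    · exact absurd (e.injective (by rw [← ht]; ext y; simp)) hik
    · simp only [pow_one, hτ]
      linear_combination (p : ℝ)⁻¹ ^ 2 * hQ'
    · simp only [pow_succ, pow_zero, one_mul,
        AlgHom.mul_apply, hτ]
      linear_combination (p : ℝ)⁻¹ ^ 2 * hQ'

end Cubic

/-- In dimension 3, negating a matrix flips the sign of its determinant, and a lattice is stable
under negation. -/
theorem exists_rotation_of_orthogonal {A : Matrix (Fin 3) (Fin 3) ℝ}
    (hA : A ∈ Matrix.orthogonalGroup (Fin 3) ℝ) {Λ Λ' : Submodule ℤ (Fin 3 → ℝ)}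
    (h : (Λ : Set (Fin 3 → ℝ)) = (fun v => A *ᵥ v) '' (Λ' : Set (Fin 3 → ℝ))) :
    IsRotatedVersion Λ Λ' := by
  have h1 := (Matrix.mem_orthogonalGroup_iff (Fin 3) ℝ).mp hA
  have hdet : A.det = 1 ∨ A.det = -1 := by
    have := congrArg Matrix.det h1
    rw [Matrix.det_mul, Matrix.det_transpose, Matrix.det_one] at this
    exact mul_self_eq_one_iff.mp this
  rcases hdet with hd | hd
  · exact ⟨A, Matrix.mem_specialOrthogonalGroup_iff.mpr ⟨hA, hd⟩, h⟩
  · refine ⟨-A, Matrix.mem_specialOrthogonalGroup_iff.mpr ⟨?_, ?_⟩, ?_⟩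
    · rw [Matrix.mem_orthogonalGroup_iff]
      simpa using h1
    · rw [Matrix.det_neg, hd]
      norm_num
    · rw [h]
      ext v
      constructor
      · rintro ⟨w, hw, rfl⟩
        exact ⟨-w, Λ'.neg_mem hw, by simp [Matrix.neg_mulVec, Matrix.mulVec_neg]⟩
      · rintro ⟨w, hw, rfl⟩
        exact ⟨-w, Λ'.neg_mem hw, by simp [Matrix.neg_mulVec, Matrix.mulVec_neg]⟩

/-! ### The norm of x when u is integral -/

section Norm

variable {K : Type*} [Field K] [Algebra ℚ K] {τ : K →ₐ[ℚ] K} {x : K}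
  {p : ℕ}

theorem exists_int_norm_eq {y : K} (hy : IsIntegral ℤ y) : ∃ n : ℤ, Algebra.norm ℚ y = n := by
  obtain ⟨n, hn⟩ := IsIntegrallyClosed.isIntegral_iff.mp (Algebra.isIntegral_norm ℚ hy)
  exact ⟨n, hn.symm⟩

theorem one_le_abs_norm [FiniteDimensional ℚ K] {y : K} (hy : IsIntegral ℤ y) (h0 : y ≠ 0) :
    1 ≤ |Algebra.norm ℚ y| := by
  obtain ⟨n, hn⟩ := exists_int_norm_eq hy
  have h := Algebra.norm_ne_zero_iff (R := ℚ).mpr h0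
  rw [hn] at h ⊢
  exact_mod_cast Int.one_le_abs (by exact_mod_cast h)

/-- If the conjugates of `x` are orthogonal and `x` generates an ideal stable under conjugation,
then `N(x) = ±p²` as soon as `p² ∣ N(x)`. -/
theorem abs_norm_eq_sq [CharZero K] [FiniteDimensional ℚ K] (hp : p.Prime)
    (hK : Module.finrank ℚ K = 3)
    (hτ : ∀ y, τ (τ (τ y)) = y)
    (hP : x ^ 2 + τ x ^ 2 + τ (τ x) ^ 2 = (p : K) ^ 2)
    (hQ : x * τ x + τ x * τ (τ x) + τ (τ x) * x = 0) (f : K →+* ℝ)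
    {u : K} (hu : IsIntegral ℤ u) (hux : τ x = u * x)
    {n : ℤ} (hn : Algebra.norm ℚ x = n) (hdvd : (p : ℤ) ^ 2 ∣ n) :
    |Algebra.norm ℚ x| = (p : ℚ) ^ 2 := by
  obtain ⟨-, h1, h2⟩ := ne_of_orthogonal_conjugates hp.ne_zero hτ hP hQ
  have hp0 : (0 : ℝ) < p := by exact_mod_cast hp.pos
  have hτu : IsIntegral ℤ (τ u) := hu.map (τ.restrictScalars ℤ)
  have hw : IsIntegral ℤ (1 + u ^ 2 + (u * τ u) ^ 2) :=
    (isIntegral_one.add (hu.pow 2)).add ((hu.mul hτu).pow 2)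
  obtain ⟨k, hk⟩ := exists_int_norm_eq hw
  -- The conjugates of x are ux and uτ(u)x, so this is the sum-of-squares relation with x² factored
  -- out; its norm gives N(x)² ∣ p⁶.
  have hprod : x ^ 2 * (1 + u ^ 2 + (u * τ u) ^ 2) = algebraMap ℚ K ((p : ℚ) ^ 2) := by
    rw [map_pow, map_natCast, ← hP, hux, map_mul, hux]
    ring
  have hn6 : n ^ 2 * k = (p : ℤ) ^ 6 := by
    have := congrArg (Algebra.norm ℚ) hprod
    rw [map_mul, map_pow, hn, hk, Algebra.norm_algebraMap, hK] at this
    have h' : (n : ℚ) ^ 2 * k = (p : ℚ) ^ 6 := by rw [this]; ring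
    exact_mod_cast h'
  have hn3 : n.natAbs ∣ p ^ 3 := by
    have h : n ^ 2 ∣ ((p : ℤ) ^ 3) ^ 2 := ⟨k, by rw [hn6]; ring⟩
    have h' := (Int.pow_dvd_pow_iff two_ne_zero).mp h
    have := Int.natAbs_dvd_natAbs.mpr h'
    simpa [Int.natAbs_pow] using this
  obtain ⟨j, hj, hnj⟩ := (Nat.dvd_prime_pow hp).mp hn3
  have hj2 : 2 ≤ j := by
    have := Int.natAbs_dvd_natAbs.mpr hdvd
    rw [hnj, Int.natAbs_pow, Int.natAbs_natCast] at this
    exact (Nat.pow_dvd_pow_iff_le_right hp.one_lt).mp this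
  have habs : |Algebra.norm ℚ x| = (p : ℚ) ^ j := by
    rw [hn, ← Int.cast_abs, Int.abs_eq_natAbs, hnj]
    simp
  -- The squares of the real conjugates would have sum q = p² and product q³. A bound weaker than
  -- AM-GM suffices: ab ≤ q²/4 and c ≤ q.
  have hj3 : j ≠ 3 := by
    rintro rfl
    have hs := sum_mul_conjugates_eq f hP
    have hN : (f x ^ 2) * (f (τ x) ^ 2) * (f (τ (τ x)) ^ 2) = ((p : ℝ) ^ 2) ^ 3 := by
      have h := congrArg f (norm_eq_mul_conjugates hK hτ h1 h2 x)
      rw [eq_ratCast, map_ratCast, map_mul, map_mul] at h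
      rw [← mul_pow, ← mul_pow, ← h, ← sq_abs, ← Rat.cast_abs, habs]
      push_cast
      ring
    have ha := sq_nonneg (f x)
    have hb := sq_nonneg (f (τ x))
    have hc := sq_nonneg (f (τ (τ x)))
    have hp2 : 0 < (p : ℝ) ^ 2 := by positivity
    generalize f x ^ 2 = a at *
    generalize f (τ x) ^ 2 = b at *
    generalize f (τ (τ x)) ^ 2 = c at *
    generalize (p : ℝ) ^ 2 = q at *
    have hab : a * b ≤ q ^ 2 / 4 := by nlinarith [sq_nonneg (a - b)]
    have habc : a * b * c ≤ q ^ 2 / 4 * q :=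
      mul_le_mul hab (by linarith) hc (by positivity)
    have : 0 < q ^ 3 := by positivity
    nlinarith
  rw [habs, show j = 2 by omega]

end Norm

/-! ### The module M as a copy of D_3, and its product distance -/

section Lattice

variable {L : Type*} [Field L] [CharZero L] {σ : L ≃ₐ[ℚ] L} {x : fixedK σ 3} {p : ℕ}

theorem mem_moduleM_three_iff {y : fixedK σ 3} :
    y ∈ moduleM σ 3 x ↔ ∃ a : Fin 3 → ℤ, (∃ m : ℤ, ∑ i, a i = 2 * m) ∧
      y = ∑ i, (a i : fixedK σ 3) * (sigmaK σ 3 ^ (i : ℕ)) x := by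
  constructor
  · intro hy
    induction hy using Submodule.span_induction with
    | mem y hy =>
      rcases hy with rfl | ⟨i, hi, rfl⟩
      · exact ⟨![1, 1, 0], ⟨1, by simp [Fin.sum_univ_three]⟩, by simp [Fin.sum_univ_three]⟩
      · obtain rfl | rfl : i = 0 ∨ i = 1 := by omega
        · exact ⟨![1, -1, 0], ⟨0, by simp [Fin.sum_univ_three]⟩,
            by simp [Fin.sum_univ_three, sub_eq_add_neg]⟩
        · exact ⟨![0, 1, -1], ⟨0, by simp [Fin.sum_univ_three]⟩,
            by simp [Fin.sum_univ_three, sub_eq_add_neg]⟩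
    | zero => exact ⟨0, ⟨0, by simp⟩, by simp⟩
    | add y z _ _ hy hz =>
      obtain ⟨a, ⟨m, hm⟩, rfl⟩ := hy
      obtain ⟨b, ⟨k, hk⟩, rfl⟩ := hz
      refine ⟨a + b, ⟨m + k, ?_⟩, ?_⟩
      · simp only [Pi.add_apply, Finset.sum_add_distrib, hm, hk]
        ring
      · simp [add_mul, Finset.sum_add_distrib]
    | smul c y _ hy =>
      obtain ⟨a, ⟨m, hm⟩, rfl⟩ := hy
      refine ⟨c • a, ⟨c * m, ?_⟩, ?_⟩
      · simp only [Pi.smul_apply, smul_eq_mul, ← Finset.mul_sum, hm]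
        ring
      · simp [Finset.mul_sum, mul_assoc]
  · rintro ⟨a, ⟨m, hm⟩, rfl⟩
    have h0 : x + sigmaK σ 3 x ∈ moduleM σ 3 x := Submodule.subset_span (Or.inl rfl)
    have h1 : x - sigmaK σ 3 x ∈ moduleM σ 3 x :=
      Submodule.subset_span (Or.inr ⟨0, by norm_num, by simp⟩)
    have h2 : sigmaK σ 3 x - (sigmaK σ 3 ^ 2) x ∈ moduleM σ 3 x :=
      Submodule.subset_span (Or.inr ⟨1, by norm_num, by simp⟩)
    -- Matching the coefficients of x and τ²x forces these multipliers; that of τx is then 2m - a₀ -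
    -- a₂ = a₁.
    have h := add_mem (add_mem (Submodule.smul_mem _ m h0) (Submodule.smul_mem _ (a 0 - m) h1))
      (Submodule.smul_mem _ (-a 2) h2)
    rw [Fin.sum_univ_three] at hm
    convert h using 1
    have ha : (a 1 : fixedK σ 3) = 2 * m - a 0 - a 2 := by
      rw [eq_sub_iff_add_eq, eq_sub_iff_add_eq]
      exact_mod_cast (by linarith : a 1 + a 2 + a 0 = 2 * m)
    simp only [Fin.sum_univ_three, zsmul_eq_mul, Fin.val_zero, Fin.val_one, Fin.val_two, pow_zero,
      pow_one, AlgHom.one_apply, ha]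
    push_cast
    ring

theorem map_moduleM_eq_image (e : Fin 3 ≃ (fixedK σ 3 →+* ℝ)) :
    ((moduleM σ 3 x).map (twistedHom e (1 / (p : fixedK σ 3) ^ 2)) : Set (Fin 3 → ℝ)) =
      (fun v => conjugateMatrix (sigmaK σ 3) x p e *ᵥ v) '' (Dlat 3 : Set (Fin 3 → ℝ)) := by
  have key : ∀ a : Fin 3 → ℤ, twistedHom e (1 / (p : fixedK σ 3) ^ 2)
      (∑ i, (a i : fixedK σ 3) * (sigmaK σ 3 ^ (i : ℕ)) x) =
        conjugateMatrix (sigmaK σ 3) x p e *ᵥ fun i => (a i : ℝ) := by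
    intro a
    ext i
    rw [twistedHom_apply_one_div_sq]
    simp only [Fin.sum_univ_three, Matrix.mulVec, dotProduct, conjugateMatrix, Matrix.of_apply,
      map_add, map_mul, map_intCast]
    ring
  ext v
  constructor
  · rintro ⟨y, hy, rfl⟩
    obtain ⟨a, hm, rfl⟩ := mem_moduleM_three_iff.mp hy
    exact ⟨fun i => a i, ⟨a, fun i => rfl, hm⟩, (key a).symm⟩
  · rintro ⟨w, ⟨a, ha, hm⟩, rfl⟩
    refine ⟨_, mem_moduleM_three_iff.mpr ⟨a, hm, rfl⟩, ?_⟩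
    rw [key a, ← funext ha]

theorem hasMaximumDiversity_map {F : Type*} [Field F] {n : ℕ} (hp : p ≠ 0)
    (e : Fin n ≃ (F →+* ℝ)) (M : Submodule ℤ F) :
    HasMaximumDiversity (M.map (twistedHom e (1 / (p : F) ^ 2))) := by
  have hp' : (p : ℝ) ≠ 0 := by positivity
  rintro _ ⟨y, -, rfl⟩ hv i
  have hy : y ≠ 0 := by
    rintro rfl
    exact hv (map_zero _)
  simp [twistedHom, hp', hy]

theorem minProductDistance_map_moduleM [FiniteDimensional ℚ (fixedK σ 3)] (hp : p.Prime)
    (hK : Module.finrank ℚ (fixedK σ 3) = 3)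
    (hτ : ∀ y, sigmaK σ 3 (sigmaK σ 3 (sigmaK σ 3 y)) = y)
    (hP : x ^ 2 + sigmaK σ 3 x ^ 2 + sigmaK σ 3 (sigmaK σ 3 x) ^ 2 = (p : fixedK σ 3) ^ 2)
    (hQ : x * sigmaK σ 3 x + sigmaK σ 3 x * sigmaK σ 3 (sigmaK σ 3 x) +
      sigmaK σ 3 (sigmaK σ 3 x) * x = 0)
    {u : fixedK σ 3} (hu : IsIntegral ℤ u) (hux : sigmaK σ 3 x = u * x)
    (hN : |Algebra.norm ℚ x| = (p : ℚ) ^ 2) (e : Fin 3 ≃ (fixedK σ 3 →+* ℝ)) :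
    minProductDistance ((moduleM σ 3 x).map (twistedHom e (1 / (p : fixedK σ 3) ^ 2))) =
      1 / (p : ℝ) := by
  obtain ⟨hx, h1, h2⟩ := ne_of_orthogonal_conjugates hp.ne_zero hτ hP hQ
  have hp0 : (0 : ℝ) < p := by exact_mod_cast hp.pos
  have hprod : ∀ y, |∏ i, twistedHom e (1 / (p : fixedK σ 3) ^ 2) y i| =
      ((p : ℝ)⁻¹) ^ 3 * ((|Algebra.norm ℚ y| : ℚ) : ℝ) := by
    intro y
    simp only [twistedHom_apply_one_div_sq, Finset.prod_mul_distrib, Finset.prod_const,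
      Finset.card_univ, Fintype.card_fin, prod_embeddings_eq_norm hK hτ h1 h2 e y, abs_mul]
    rw [abs_of_pos (by positivity), Rat.cast_abs]
  have hne : x + sigmaK σ 3 x ≠ 0 := by
    intro h
    have := norm_add_conjugate hp.ne_zero hK hτ hP hQ
    rw [h, Algebra.norm_zero, eq_comm, neg_eq_zero, Algebra.norm_eq_zero_iff] at this
    exact hx this
  apply IsLeast.csInf_eq
  constructor
  · refine ⟨_, ⟨x + sigmaK σ 3 x, Submodule.subset_span (Or.inl rfl), rfl⟩, ?_, ?_⟩
    · intro h
      have := congrFun h 0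
      rw [twistedHom_apply_one_div_sq] at this
      simp [hp0.ne', -map_add, hne] at this
    · rw [hprod, norm_add_conjugate hp.ne_zero hK hτ hP hQ, abs_neg, hN]
      push_cast
      field_simp
  · rintro _ ⟨_, ⟨y, hy, rfl⟩, hv, rfl⟩
    have hy0 : y ≠ 0 := by
      rintro rfl
      exact hv (map_zero _)
    obtain ⟨a, -, rfl⟩ := mem_moduleM_three_iff.mp hy
    have hτu : IsIntegral ℤ (sigmaK σ 3 u) := hu.map ((sigmaK σ 3).restrictScalars ℤ)
    have hfac : ∑ i, (a i : fixedK σ 3) * (sigmaK σ 3 ^ (i : ℕ)) x =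
        x * (a 0 + a 1 * u + a 2 * (sigmaK σ 3 u * u)) := by
      simp only [Fin.sum_univ_three, Fin.val_zero, Fin.val_one, Fin.val_two, pow_zero, pow_one,
        AlgHom.one_apply, pow_two, AlgHom.mul_apply, hux, map_mul]
      ring
    have hint : ∀ c : ℤ, IsIntegral ℤ (c : fixedK σ 3) := fun c => isIntegral_algebraMap
    have hw : IsIntegral ℤ ((a 0 : fixedK σ 3) + a 1 * u + a 2 * (sigmaK σ 3 u * u)) :=
      ((hint _).add ((hint _).mul hu)).add ((hint _).mul (hτu.mul hu))
    change 1 / (p : ℝ) ≤ |∏ i, twistedHom e (1 / (p : fixedK σ 3) ^ 2) _ i|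
    rw [hfac] at hy0
    rw [hprod, hfac]
    have h := one_le_abs_norm hw (right_ne_zero_of_mul hy0)
    rw [map_mul, abs_mul, hN]
    have h' : (1 : ℝ) ≤ ((|Algebra.norm ℚ ((a 0 : fixedK σ 3) + a 1 * u +
      a 2 * (sigmaK σ 3 u * u))| : ℚ) : ℝ) := by exact_mod_cast h
    rw [Rat.cast_mul, ← mul_assoc]
    push_cast at h' ⊢
    calc 1 / (p : ℝ) = (p : ℝ)⁻¹ ^ 3 * (p : ℝ) ^ 2 * 1 := by field_simp
      _ ≤ _ := mul_le_mul_of_nonneg_left h' (by positivity)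

end Lattice

/-! ### Powers of a primitive root modulo `p` -/

section PrimitiveRoot

variable {p r k : ℕ}

/-- The residues of r^n for n < p - 1 run once through 1, …, p - 1, and F depends only on the
residue. -/
theorem prod_range_pow_primitiveRoot {M : Type*} [CommMonoid M] (hp : p.Prime)
    (hr : IsPrimitiveRoot (r : ZMod p) (p - 1)) (F : ℕ → M) (hF : ∀ a, F (a % p) = F a) :
    ∏ n ∈ Finset.range (p - 1), F (r ^ n) = ∏ n ∈ Finset.range (p - 1), F (n + 1) := by
  have : Fact p.Prime := ⟨hp⟩
  have hr0 : (r : ZMod p) ≠ 0 := hr.ne_zero (by have := hp.two_le; omega)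
  have hinj : Set.InjOn (fun n => r ^ n % p) (Finset.range (p - 1) : Set ℕ) := by
    intro a ha b hb hab
    rw [Finset.coe_range, Set.mem_Iio] at ha hb
    have : ((r ^ a : ℕ) : ZMod p) = (r ^ b : ℕ) := (ZMod.natCast_eq_natCast_iff _ _ _).mpr hab
    push_cast at this
    exact hr.pow_inj ha hb this
  have himg : (Finset.range (p - 1)).image (fun n => r ^ n % p) = Finset.Ico 1 p := by
    apply Finset.eq_of_subset_of_card_le
    · intro a ha
      obtain ⟨n, -, rfl⟩ := Finset.mem_image.mp ha
      rw [Finset.mem_Ico]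
      refine ⟨?_, Nat.mod_lt _ hp.pos⟩
      rw [Nat.one_le_iff_ne_zero]
      intro h
      have := (ZMod.natCast_eq_zero_iff (r ^ n) p).mpr (Nat.dvd_of_mod_eq_zero h)
      push_cast at this
      exact pow_ne_zero n hr0 this
    · rw [Finset.card_image_of_injOn hinj]
      simp
  calc ∏ n ∈ Finset.range (p - 1), F (r ^ n)
      = ∏ n ∈ Finset.range (p - 1), F (r ^ n % p) := by simp only [hF]
    _ = ∏ a ∈ Finset.Ico 1 p, F a := by rw [← himg, Finset.prod_image hinj]
    _ = ∏ n ∈ Finset.range (p - 1), F (n + 1) := by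
        rw [Finset.prod_Ico_eq_prod_range]
        simp only [add_comm]

theorem sum_range_pow_primitiveRoot {M : Type*} [AddCommMonoid M] (hp : p.Prime)
    (hr : IsPrimitiveRoot (r : ZMod p) (p - 1)) (F : ℕ → M) (hF : ∀ a, F (a % p) = F a) :
    ∑ n ∈ Finset.range (p - 1), F (r ^ n) = ∑ n ∈ Finset.range (p - 1), F (n + 1) :=
  prod_range_pow_primitiveRoot (M := Multiplicative M) hp hr F hF

/-- Since r has order 6k, r^(3k) = -1, and exponents below p - 1 are determined by their powers. -/
theorem dvd_one_add_pow_primitiveRoot_iff (hp : p.Prime) (hr : IsPrimitiveRoot (r : ZMod p) (p - 1))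
    (hk : p = 6 * k + 1) {s : ℕ} (hs : s < p - 1) : p ∣ 1 + r ^ s ↔ s = 3 * k := by
  have : Fact p.Prime := ⟨hp⟩
  have hk0 : 0 < k := by have := hp.two_le; omega
  have hN : (r : ZMod p) ^ (3 * k) = -1 := by
    have h1 : (r : ZMod p) ^ (3 * k) * (r : ZMod p) ^ (3 * k) = 1 := by
      rw [← pow_add, show 3 * k + 3 * k = p - 1 by omega, hr.pow_eq_one]
    refine (mul_self_eq_one_iff.mp h1).resolve_left ?_
    exact hr.pow_ne_one_of_pos_of_lt (by omega) (by omega)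
  rw [← ZMod.natCast_eq_zero_iff]
  push_cast
  rw [add_comm, add_eq_zero_iff_eq_neg, ← hN]
  exact ⟨fun h => hr.pow_inj hs (by omega) h, fun h => by rw [h]⟩

end PrimitiveRoot

theorem sum_range_mul_three {M : Type*} [AddCommMonoid M] (F : ℕ → M) (m : ℕ) :
    ∑ n ∈ Finset.range (3 * m), F n =
      ∑ j ∈ Finset.range m, ∑ i ∈ Finset.range 3, F (i + 3 * j) := by
  induction m with
  | zero => simp
  | succ m ih =>
    rw [show 3 * (m + 1) = 3 * m + 1 + 1 + 1 by ring, Finset.sum_range_succ,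
      Finset.sum_range_succ, Finset.sum_range_succ, Finset.sum_range_succ _ m, ← ih,
      Finset.sum_range_succ, Finset.sum_range_succ, Finset.sum_range_one]
    simp only [add_assoc, zero_add, add_comm (3 * m)]

/-- Consecutive terms cancel, because 3 is odd and the number of terms is even. -/
theorem sum_range_two_mul_neg_one_pow {R : Type*} [CommRing R] (k t : ℕ) :
    ∑ j ∈ Finset.range (2 * k), (-1 : R) ^ (t + 3 * j) = 0 := by
  induction k with
  | zero => simp
  | succ k ih =>
    rw [show 2 * (k + 1) = 2 * k + 1 + 1 by ring, Finset.sum_range_succ, Finset.sum_range_succ, ih]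
    ring

/-! ### The cyclotomic field -/

section Cyclotomic

variable {p r k : ℕ} {l : ℤ} {L : Type*} [Field L] [CharZero L] {ζ : L} {σ : L ≃ₐ[ℚ] L}

theorem pow_apply_root (hσ : σ ζ = ζ ^ r) (n : ℕ) : (σ ^ n) ζ = ζ ^ r ^ n := by
  induction n with
  | zero => simp
  | succ n ih => rw [pow_succ, AlgEquiv.mul_apply, hσ, map_pow, ih, ← pow_mul, pow_succ]

omit [CharZero L] in
theorem pow_mod_primitiveRoot (hζ : IsPrimitiveRoot ζ p) (a : ℕ) : ζ ^ (a % p) = ζ ^ a := by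
  rw [hζ.eq_orderOf, pow_mod_orderOf]

theorem orderOf_eq_sub_one [IsCyclotomicExtension {p} ℚ L] (hp : p.Prime)
    (hζ : IsPrimitiveRoot ζ p) (hr : IsPrimitiveRoot (r : ZMod p) (p - 1))
    (hσ : σ ζ = ζ ^ r) : orderOf σ = p - 1 := by
  have : NeZero p := ⟨hp.ne_zero⟩
  have := IsCyclotomicExtension.isGalois {p} ℚ L
  have := IsCyclotomicExtension.finiteDimensional {p} ℚ L
  apply Nat.dvd_antisymm
  · rw [orderOf_dvd_iff_pow_eq_one, ← Nat.totient_prime hp,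
      ← IsCyclotomicExtension.Rat.finrank p L, ← IsGalois.card_aut_eq_finrank]
    exact pow_card_eq_one'
  · apply hr.dvd_of_pow_eq_one
    have h := pow_apply_root hσ (orderOf σ)
    rw [pow_orderOf_eq_one, AlgEquiv.one_apply] at h
    have h' : ζ ^ (1 % p) = ζ ^ (r ^ orderOf σ % p) := by
      rw [pow_mod_primitiveRoot hζ, pow_mod_primitiveRoot hζ, pow_one, ← h]
    have h2 := hζ.pow_inj (Nat.mod_lt _ hp.pos) (Nat.mod_lt _ hp.pos) h'
    have h3 := (ZMod.natCast_eq_natCast_iff 1 (r ^ orderOf σ) p).mpr h2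
    push_cast at h3
    exact h3.symm

omit [CharZero L] in
theorem sum_root_pow (hp : p.Prime) (hζ : IsPrimitiveRoot ζ p)
    (hr : IsPrimitiveRoot (r : ZMod p) (p - 1)) (a : ℕ) :
    ∑ n ∈ Finset.range (p - 1), ζ ^ (r ^ n * a) = (if p ∣ a then (p : L) else 0) - 1 := by
  rw [sum_range_pow_primitiveRoot hp hr (fun b => ζ ^ (b * a)) fun b => by
    simp only [pow_mul, pow_mod_primitiveRoot hζ]]
  have h : ∑ n ∈ Finset.range (p - 1 + 1), ζ ^ (n * a) = if p ∣ a then (p : L) else 0 := by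
    rw [Nat.sub_add_cancel hp.one_lt.le]
    split_ifs with ha
    · obtain ⟨b, rfl⟩ := ha
      simp [mul_left_comm _ p, pow_mul, hζ.pow_eq_one]
    · have h1 : IsPrimitiveRoot (ζ ^ a) p :=
        hζ.pow_of_coprime a ((hp.coprime_iff_not_dvd.mpr ha).symm)
      simpa only [mul_comm _ a, pow_mul] using h1.geom_sum_eq_zero hp.one_lt
  rw [Finset.sum_range_succ'] at h
  rw [← h]
  simp

/-- The element `ζ^l α`, which `σ` maps to its negative. -/
def rootElt (p r : ℕ) (l : ℤ) (ζ : L) : L := ζ ^ l * alphaElt p r ζ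

omit [CharZero L] in
theorem root_zpow_eq_one (hζ : IsPrimitiveRoot ζ p) {c : ℤ} (hc : (p : ℤ) ∣ c) : ζ ^ c = 1 :=
  (hζ.zpow_eq_one_iff_dvd c).mpr hc

/-- σ shifts the product α, replacing its factor 1 - ζ by 1 - ζ⁻¹ = -ζ⁻¹(1 - ζ). The choice of l
gives σ(ζ^l) = ζ^l ζ, which absorbs the ζ⁻¹. -/
theorem apply_rootElt (hp : p.Prime) (hζ : IsPrimitiveRoot ζ p)
    (hr : IsPrimitiveRoot (r : ZMod p) (p - 1)) (hσ : σ ζ = ζ ^ r) (hk : p = 6 * k + 1)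
    (hl : l * ((r : ℤ) - 1) ≡ 1 [ZMOD (p : ℤ)]) :
    σ (rootElt p r l ζ) = -rootElt p r l ζ := by
  have hζ0 : ζ ≠ 0 := hζ.ne_zero hp.ne_zero
  have hN : ζ ^ (1 + r ^ (3 * k)) = 1 := by
    rw [hζ.pow_eq_one_iff_dvd, dvd_one_add_pow_primitiveRoot_iff hp hr hk (by
      have := hp.two_le; omega)]
  have h1 : (1 - ζ) ≠ 0 := sub_ne_zero.mpr (hζ.ne_one hp.one_lt).symm
  have hα : σ (alphaElt p r ζ) * (1 - ζ) = alphaElt p r ζ * (1 - ζ ^ r ^ (3 * k)) := by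
    have hN2 : (p - 1) / 2 = 3 * k := by omega
    rw [alphaElt, hN2, ← Finset.prod_range_succ, Finset.prod_range_succ', map_prod]
    simp only [map_sub, map_one, map_pow, hσ, pow_zero, pow_one, ← pow_mul, pow_succ', mul_comm]
  have hz : σ (ζ ^ l) = ζ ^ l * ζ := by
    rw [map_zpow₀, hσ, ← zpow_natCast, ← zpow_mul, ← zpow_add_one₀ hζ0,
      ← div_eq_one_iff_eq (zpow_ne_zero _ hζ0), ← zpow_sub₀ hζ0]
    apply root_zpow_eq_one hζ
    have := hl.symm.dvd
    convert this using 1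
    ring
  apply mul_right_cancel₀ h1
  rw [rootElt, map_mul, hz, mul_assoc, hα]
  rw [pow_add, pow_one] at hN
  linear_combination -ζ ^ l * alphaElt p r ζ * hN

theorem pow_apply_rootElt (h : σ (rootElt p r l ζ) = -rootElt p r l ζ) (n : ℕ) :
    (σ ^ n) (rootElt p r l ζ) = (-1) ^ n * rootElt p r l ζ := by
  induction n with
  | zero => simp
  | succ n ih => rw [pow_succ, AlgEquiv.mul_apply, h, map_neg, ih, pow_succ]; ring

/-- σ^(3k) inverts ζ and sends α to the complementary half of ∏(1 - ζ^a) = p, so w σ^(3k)(w) = p;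
and σ^(3k)(w) = (-1)^(3k) w. -/
theorem rootElt_sq (hp : p.Prime) (hζ : IsPrimitiveRoot ζ p)
    (hr : IsPrimitiveRoot (r : ZMod p) (p - 1)) (hσ : σ ζ = ζ ^ r) (hk : p = 6 * k + 1)
    (h : σ (rootElt p r l ζ) = -rootElt p r l ζ) :
    (-1) ^ (3 * k) * rootElt p r l ζ ^ 2 = p := by
  have hN : ζ ^ (1 + r ^ (3 * k)) = 1 := by
    rw [hζ.pow_eq_one_iff_dvd, dvd_one_add_pow_primitiveRoot_iff hp hr hk (by
      have := hp.two_le; omega)]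
  have h1 := pow_apply_rootElt h (3 * k)
  have h2 : rootElt p r l ζ * (σ ^ (3 * k)) (rootElt p r l ζ) = p := by
    have hz : ζ ^ l * (σ ^ (3 * k)) (ζ ^ l) = 1 := by
      rw [map_zpow₀, pow_apply_root hσ, ← mul_zpow, ← pow_succ', add_comm, hN, one_zpow]
    have hN2 : (p - 1) / 2 = 3 * k := by omega
    have hα : alphaElt p r ζ * (σ ^ (3 * k)) (alphaElt p r ζ) = p := by
      have hsplit : p - 1 = 3 * k + 3 * k := by omega
      have hall : ∏ n ∈ Finset.range (p - 1), (1 - ζ ^ r ^ n) = p := by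
        rw [prod_range_pow_primitiveRoot hp hr (fun b => 1 - ζ ^ b) fun b => by
          simp only [pow_mod_primitiveRoot hζ]]
        have hp1 : p - 1 + 1 = p := Nat.sub_add_cancel hp.one_lt.le
        rw [IsPrimitiveRoot.prod_one_sub_pow_eq_order (by rwa [hp1])]
        exact_mod_cast congrArg (Nat.cast (R := L)) hp1
      rw [alphaElt, hN2, map_prod, ← hall, hsplit, Finset.prod_range_add]
      simp only [map_sub, map_one, map_pow, pow_apply_root hσ, ← pow_mul, pow_add]
    rw [rootElt, map_mul]
    linear_combination (alphaElt p r ζ * (σ ^ (3 * k)) (alphaElt p r ζ)) * hz + hα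
  rw [h1] at h2
  linear_combination h2

/-! ### Correlations of the conjugates of z -/

theorem pow_apply_zElt (hσ : σ ζ = ζ ^ r) (h : σ (rootElt p r l ζ) = -rootElt p r l ζ) (n : ℕ) :
    (σ ^ n) (zElt p r l ζ) = (-1) ^ n * rootElt p r l ζ * (1 - ζ ^ r ^ n) := by
  rw [zElt, map_mul, ← rootElt, pow_apply_rootElt h, map_sub, map_one, pow_apply_root hσ]

/-- Expanding (1 - ζ^a)(1 - ζ^b), the four sums are p - 1, 1, 1 and either p - 1 or -1. -/
theorem sum_conjugates_zElt_mul (hp : p.Prime) (hζ : IsPrimitiveRoot ζ p)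
    (hr : IsPrimitiveRoot (r : ZMod p) (p - 1)) (hσ : σ ζ = ζ ^ r)
    (h : σ (rootElt p r l ζ) = -rootElt p r l ζ) (s : ℕ) :
    ∑ n ∈ Finset.range (p - 1), (σ ^ n) (zElt p r l ζ * (σ ^ s) (zElt p r l ζ)) =
      (-1) ^ s * rootElt p r l ζ ^ 2 * (p * (1 + if p ∣ 1 + r ^ s then 1 else 0)) := by
  have hterm : ∀ n, (σ ^ n) (zElt p r l ζ * (σ ^ s) (zElt p r l ζ)) =
      (-1) ^ s * rootElt p r l ζ ^ 2 *
        (1 - ζ ^ (r ^ n * 1) - ζ ^ (r ^ n * r ^ s) + ζ ^ (r ^ n * (1 + r ^ s))) := by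
    intro n
    rw [map_mul, ← AlgEquiv.mul_apply, ← pow_add, pow_apply_zElt hσ h, pow_apply_zElt hσ h]
    have : ((-1 : L) ^ n) * (-1) ^ n = 1 := by rw [← mul_pow]; simp
    have hexp : ζ ^ (r ^ n * (1 + r ^ s)) = ζ ^ r ^ n * ζ ^ r ^ (n + s) := by
      rw [mul_add, mul_one, pow_add ζ, ← pow_add r]
    rw [hexp, mul_one, ← pow_add r, pow_add (-1 : L)]
    linear_combination
      ((-1) ^ s * rootElt p r l ζ ^ 2 * (1 - ζ ^ r ^ n) * (1 - ζ ^ r ^ (n + s))) * this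
  have hr0 : ¬ p ∣ r ^ s := by
    have : Fact p.Prime := ⟨hp⟩
    rw [← ZMod.natCast_eq_zero_iff]
    push_cast
    exact pow_ne_zero s (hr.ne_zero (by have := hp.two_le; omega))
  simp only [hterm]
  rw [← Finset.mul_sum, Finset.sum_add_distrib, Finset.sum_sub_distrib, Finset.sum_sub_distrib,
    sum_root_pow hp hζ hr, sum_root_pow hp hζ hr, sum_root_pow hp hζ hr, if_neg hr0,
    if_neg (Nat.Prime.not_dvd_one hp), Finset.sum_const, Finset.card_range, nsmul_eq_mul,
    Nat.cast_sub hp.one_lt.le]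
  split_ifs <;> push_cast <;> ring

/-! ### The cubic field, its trace, and the two relations -/

theorem finrank_fixedK_three [IsCyclotomicExtension {p} ℚ L] (hp : p.Prime)
    (hk : p = 6 * k + 1) (hord : orderOf σ = p - 1) :
    Module.finrank ℚ (fixedK σ 3) = 3 := by
  have : NeZero p := ⟨hp.ne_zero⟩
  have := IsCyclotomicExtension.finiteDimensional {p} ℚ L
  have h1 := Module.finrank_mul_finrank ℚ (fixedK σ 3) L
  have hk0 : 0 < k := by have := hp.two_le; omega
  rw [IsCyclotomicExtension.Rat.finrank p L, Nat.totient_prime hp, fixedK,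
    IntermediateField.finrank_fixedField_eq_card, Nat.card_zpowers, orderOf_pow, hord,
    show p - 1 = 2 * k * 3 by omega, Nat.gcd_mul_left_left, Nat.mul_div_cancel _ (by norm_num),
    mul_comm] at h1
  exact Nat.eq_of_mul_eq_mul_left (by omega) h1

theorem coe_trace_fixedK_three [IsCyclotomicExtension {p} ℚ L] (hp : p.Prime)
    (hk : p = 6 * k + 1) (hord : orderOf σ = p - 1) (y : L) :
    (Algebra.trace (fixedK σ 3) L y : L) =
      ∑ j ∈ Finset.range (2 * k), (σ ^ (3 * j)) y := by
  have : NeZero p := ⟨hp.ne_zero⟩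
  have := IsCyclotomicExtension.isGalois {p} ℚ L
  have := IsCyclotomicExtension.finiteDimensional {p} ℚ L
  have hord3 : orderOf (σ ^ 3) = 2 * k := by
    rw [orderOf_pow, hord, show p - 1 = 2 * k * 3 by omega, Nat.gcd_mul_left_left,
      Nat.mul_div_cancel _ (by norm_num)]
  have h1 : (Algebra.trace (fixedK σ 3) L y : L) = ∑ g : L ≃ₐ[fixedK σ 3] L, g y :=
    trace_eq_sum_automorphisms (K := fixedK σ 3) y
  let E : Fin (orderOf (σ ^ 3)) ≃ (L ≃ₐ[fixedK σ 3] L) :=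
    (finEquivZPowers (isOfFinOrder_of_finite (σ ^ 3))).trans
      (IntermediateField.subgroupEquivAlgEquiv (Subgroup.zpowers (σ ^ 3))).toEquiv
  have hE : ∀ j, E j y = (σ ^ (3 * (j : ℕ))) y := by
    intro j
    rw [pow_mul]
    rfl
  rw [h1, ← Equiv.sum_comp E fun g => g y]
  simp only [hE]
  rw [← hord3, Finset.sum_range]

theorem coe_sigmaK (n : ℕ) (y : fixedK σ n) : (sigmaK σ n y : L) = σ y := rfl

theorem sigmaK_three_cubed (y : fixedK σ 3) : sigmaK σ 3 (sigmaK σ 3 (sigmaK σ 3 y)) = y := by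
  apply Subtype.ext
  simp only [coe_sigmaK]
  have hy : (y : L) ∈ IntermediateField.fixedField (Subgroup.zpowers (σ ^ 3)) := y.2
  rw [IntermediateField.mem_fixedField_iff] at hy
  have := hy (σ ^ 3) (Subgroup.mem_zpowers _)
  simpa [pow_succ] using this

/-- The sum of the conjugates of `x σ^t(x)`, where `x` is the trace of `z`, expressed through
conjugates of `z`. -/
theorem sum_conjugates_trace_mul {z X : L} (hk : p = 6 * k + 1)
    (hX : X = ∑ j ∈ Finset.range (2 * k), (σ ^ (3 * j)) z) (h3 : (σ ^ 3) X = X) (t : ℕ) :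
    ∑ i ∈ Finset.range 3, (σ ^ i) (X * (σ ^ t) X) =
      ∑ j ∈ Finset.range (2 * k), ∑ n ∈ Finset.range (p - 1),
        (σ ^ n) (z * (σ ^ (t + 3 * j)) z) := by
  have h3j : ∀ j, (σ ^ (3 * j)) X = X := by
    intro j
    induction j with
    | zero => simp
    | succ j ih => rw [mul_add, mul_one, pow_add, AlgEquiv.mul_apply, h3, ih]
  have h1 : ∀ i, (σ ^ i) (X * (σ ^ t) X) =
      ∑ j ∈ Finset.range (2 * k), (σ ^ (i + 3 * j)) (z * (σ ^ t) X) := by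
    intro i
    have : X * (σ ^ t) X = ∑ j ∈ Finset.range (2 * k), (σ ^ (3 * j)) (z * (σ ^ t) X) := by
      have hmul : X * (σ ^ t) X =
          (∑ j ∈ Finset.range (2 * k), (σ ^ (3 * j)) z) * (σ ^ t) X := by rw [← hX]
      rw [hmul, Finset.sum_mul]
      refine Finset.sum_congr rfl fun j _ => ?_
      rw [map_mul, ← AlgEquiv.mul_apply _ (σ ^ t), ← pow_add, add_comm, pow_add,
        AlgEquiv.mul_apply, h3j]
    rw [this, map_sum]
    simp only [pow_add, AlgEquiv.mul_apply]
  have h2 : z * (σ ^ t) X = ∑ j ∈ Finset.range (2 * k), z * (σ ^ (t + 3 * j)) z := by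
    have hmul : z * (σ ^ t) X =
        z * (σ ^ t) (∑ j ∈ Finset.range (2 * k), (σ ^ (3 * j)) z) := by rw [← hX]
    rw [hmul, map_sum, Finset.mul_sum]
    simp only [pow_add, AlgEquiv.mul_apply]
  simp only [h1]
  -- The exponents i + 3j with i < 3 and j < 2k enumerate all n < p - 1.
  rw [Finset.sum_comm, ← sum_range_mul_three fun n => (σ ^ n) (z * (σ ^ t) X),
    show 3 * (2 * k) = p - 1 by omega, Finset.sum_comm]
  simp only [h2, map_sum]

/-- The correlation of x with τ^t x collects those of z at shifts t + 3j. Its constant part cancels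
by alternation, and the shift 3k occurs for t = 0 but not for t = 1. -/
theorem orthogonal_conjugates_xElt [IsCyclotomicExtension {p} ℚ L] (hp : p.Prime)
    (hζ : IsPrimitiveRoot ζ p) (hr : IsPrimitiveRoot (r : ZMod p) (p - 1)) (hσ : σ ζ = ζ ^ r)
    (hk : p = 6 * k + 1) (hl : l * ((r : ℤ) - 1) ≡ 1 [ZMOD (p : ℤ)]) {x : fixedK σ 3}
    (hx : x = xElt 3 p r l ζ σ) :
    x ^ 2 + sigmaK σ 3 x ^ 2 + sigmaK σ 3 (sigmaK σ 3 x) ^ 2 = (p : fixedK σ 3) ^ 2 ∧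
    x * sigmaK σ 3 x + sigmaK σ 3 x * sigmaK σ 3 (sigmaK σ 3 x) +
      sigmaK σ 3 (sigmaK σ 3 x) * x = 0 := by
  have hord := orderOf_eq_sub_one hp hζ hr hσ
  have h := apply_rootElt hp hζ hr hσ hk hl
  have hsq := rootElt_sq hp hζ hr hσ hk h
  have hX : (x : L) = ∑ j ∈ Finset.range (2 * k), (σ ^ (3 * j)) (zElt p r l ζ) := by
    rw [hx]
    exact coe_trace_fixedK_three hp hk hord _
  have h3 : (σ ^ 3) (x : L) = x := by
    simpa [pow_succ, coe_sigmaK] using congrArg Subtype.val (sigmaK_three_cubed x)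
  have h3' : σ (σ (σ (x : L))) = x := by simpa [pow_succ] using h3
  have hsum := sum_conjugates_trace_mul hk hX h3
  simp only [sum_conjugates_zElt_mul hp hζ hr hσ h] at hsum
  have hiff : ∀ t j, t < 3 → j ∈ Finset.range (2 * k) →
      (p ∣ 1 + r ^ (t + 3 * j) ↔ t + 3 * j = 3 * k) := by
    intro t j ht hj
    rw [Finset.mem_range] at hj
    exact dvd_one_add_pow_primitiveRoot_iff hp hr hk (by omega)
  have hk0 : 0 < k := by have := hp.two_le; omega
  have hval : ∀ t, t < 3 → ∑ i ∈ Finset.range 3, (σ ^ i) ((x : L) * (σ ^ t) (x : L)) =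
      rootElt p r l ζ ^ 2 * p * ∑ j ∈ Finset.range (2 * k),
        if t + 3 * j = 3 * k then (-1) ^ (t + 3 * j) else 0 := by
    intro t ht
    have hz := sum_range_two_mul_neg_one_pow (R := L) k t
    refine (hsum t).trans ?_
    have hz' := (Finset.mul_sum _ _ (rootElt p r l ζ ^ 2 * p)).symm.trans
      ((congrArg _ hz).trans (mul_zero _))
    rw [← sub_eq_zero, Finset.mul_sum, ← Finset.sum_sub_distrib]
    refine Eq.trans ?_ hz'
    refine Finset.sum_congr rfl fun j hj => ?_
    simp only [hiff t j ht hj]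
    split_ifs <;> ring
  constructor
  · apply Subtype.ext
    have h0 := hval 0 (by norm_num)
    have hone : ∑ j ∈ Finset.range (2 * k),
        (if 0 + 3 * j = 3 * k then (-1 : L) ^ (0 + 3 * j) else 0) = (-1) ^ (3 * k) := by
      rw [Finset.sum_eq_single k]
      · simp
      · intro j _ hj
        rw [if_neg (by omega)]
      · intro hk'
        exact absurd (Finset.mem_range.mpr (by omega)) hk'
    rw [hone] at h0
    simp only [Finset.sum_range_succ, Finset.sum_range_zero, pow_succ, pow_zero, one_mul,
      AlgEquiv.mul_apply, AlgEquiv.one_apply, map_mul] at h0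
    push_cast
    simp only [coe_sigmaK]
    linear_combination h0 + (p : L) * hsq
  · apply Subtype.ext
    have h1 := hval 1 (by norm_num)
    rw [Finset.sum_eq_zero fun j _ => if_neg (by omega)] at h1
    simp only [Finset.sum_range_succ, Finset.sum_range_zero, pow_succ, pow_zero, one_mul,
      AlgEquiv.mul_apply, AlgEquiv.one_apply, map_mul, h3'] at h1
    push_cast
    simp only [coe_sigmaK]
    linear_combination h1

/-! ### Integrality and divisibility of N(x) by p² -/

omit [CharZero L] in
theorem isIntegral_zpow_root (hp : p.Prime) (hζ : IsPrimitiveRoot ζ p) (l : ℤ) :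
    IsIntegral ℤ (ζ ^ l) := by
  cases l with
  | ofNat n => simpa using (hζ.isIntegral hp.pos).pow n
  | negSucc n =>
    rw [zpow_negSucc, ← inv_pow]
    exact (hζ.inv.isIntegral hp.pos).pow _

omit [CharZero L] in
theorem isIntegral_rootElt (hp : p.Prime) (hζ : IsPrimitiveRoot ζ p) :
    IsIntegral ℤ (rootElt p r l ζ) :=
  (isIntegral_zpow_root hp hζ l).mul <| IsIntegral.prod _ fun _ _ =>
    isIntegral_one.sub ((hζ.isIntegral hp.pos).pow _)

/-- Writing x = wS with S integral, N(x) = -w³ · SσSσ²S. Squaring and using w² = ±p gives p³ ∣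
N(x)², hence p² ∣ N(x). -/
theorem exists_norm_xElt_eq [IsCyclotomicExtension {p} ℚ L] (hp : p.Prime)
    (hζ : IsPrimitiveRoot ζ p) (hr : IsPrimitiveRoot (r : ZMod p) (p - 1)) (hσ : σ ζ = ζ ^ r)
    (hk : p = 6 * k + 1) (hl : l * ((r : ℤ) - 1) ≡ 1 [ZMOD (p : ℤ)]) :
    ∃ n : ℤ, Algebra.norm ℚ (xElt 3 p r l ζ σ) = n ∧ (p : ℤ) ^ 2 ∣ n := by
  have : NeZero p := ⟨hp.ne_zero⟩
  have := IsCyclotomicExtension.finiteDimensional {p} ℚ L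
  have hord := orderOf_eq_sub_one hp hζ hr hσ
  have h := apply_rootElt hp hζ hr hσ hk hl
  have hsq := rootElt_sq hp hζ hr hσ hk h
  obtain ⟨hP, hQ⟩ := orthogonal_conjugates_xElt hp hζ hr hσ hk hl rfl
  obtain ⟨-, h1, h2⟩ := ne_of_orthogonal_conjugates hp.ne_zero sigmaK_three_cubed hP hQ
  have hnorm := norm_eq_mul_conjugates (finrank_fixedK_three hp hk hord) sigmaK_three_cubed h1 h2
    (xElt 3 p r l ζ σ)
  set x := xElt 3 p r l ζ σ with hx
  have hint := isIntegral_rootElt (r := r) (l := l) hp hζ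
  obtain ⟨S, hS, hxS⟩ : ∃ S : L, IsIntegral ℤ S ∧ (x : L) = rootElt p r l ζ * S := by
    refine ⟨∑ j ∈ Finset.range (2 * k), (-1) ^ (3 * j) * (1 - ζ ^ r ^ (3 * j)), ?_, ?_⟩
    · exact IsIntegral.sum _ fun j _ => (isIntegral_one.neg.pow _).mul
        (isIntegral_one.sub ((hζ.isIntegral hp.pos).pow _))
    · rw [hx, xElt, coe_trace_fixedK_three hp hk hord, Finset.mul_sum]
      refine Finset.sum_congr rfl fun j _ => ?_
      rw [pow_apply_zElt hσ h]
      ring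
  have hxint : IsIntegral ℤ x := by
    rw [← isIntegral_algHom_iff ((fixedK σ 3).val.restrictScalars ℤ) Subtype.val_injective]
    change IsIntegral ℤ (x : L)
    rw [hxS]
    exact hint.mul hS
  obtain ⟨n, hn⟩ := exists_int_norm_eq hxint
  refine ⟨n, hn, ?_⟩
  have hσS : IsIntegral ℤ (σ S) := hS.map (σ.toAlgHom.restrictScalars ℤ)
  have hσσS : IsIntegral ℤ (σ (σ S)) := hσS.map (σ.toAlgHom.restrictScalars ℤ)
  have hw := ((hS.mul hσS).mul hσσS).pow 2
  have hn' : (n : L) = -rootElt p r l ζ ^ 3 * (S * σ S * σ (σ S)) := by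
    have := congrArg (Subtype.val : fixedK σ 3 → L) hnorm
    rw [hn, map_intCast] at this
    push_cast at this
    rw [this, coe_sigmaK, coe_sigmaK, coe_sigmaK, hxS]
    simp only [map_mul, h, map_neg]
    ring
  have hsign : ((-1 : L) ^ (3 * k)) ^ 2 = 1 := by rw [← pow_mul, mul_comm, pow_mul]; simp
  have hn2 : (n : L) ^ 2 * (-1) ^ (3 * k) = (p : L) ^ 3 * (S * σ S * σ (σ S)) ^ 2 := by
    rw [hn', ← hsq]
    linear_combination (-(-1) ^ (3 * k) * rootElt p r l ζ ^ 6 * (S * σ S * σ (σ S)) ^ 2) * hsign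
  have hpL : (p : L) ≠ 0 := by exact_mod_cast hp.ne_zero
  -- This square is both rational and integral, hence an integer; this turns the identity in L into
  -- a divisibility in ℤ.
  have hwq : (S * σ S * σ (σ S)) ^ 2 =
      algebraMap ℚ L ((n : ℚ) ^ 2 * (-1) ^ (3 * k) / (p : ℚ) ^ 3) := by
    rw [map_div₀, eq_div_iff (by simpa using hp.ne_zero)]
    simp only [map_mul, map_pow, map_intCast, map_neg, map_one, map_natCast]
    rw [hn2, mul_comm]
  rw [hwq, isIntegral_algebraMap_iff (algebraMap ℚ L).injective,
    IsIntegrallyClosed.isIntegral_iff] at hw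
  obtain ⟨c, hc⟩ := hw
  have hpq : (p : ℚ) ^ 3 ≠ 0 := pow_ne_zero _ (by exact_mod_cast hp.ne_zero)
  rw [eq_div_iff hpq, eq_intCast] at hc
  have hc' : c * (p : ℤ) ^ 3 = n ^ 2 * (-1) ^ (3 * k) := by exact_mod_cast hc
  have hpZ := Nat.prime_iff_prime_int.mp hp
  have hd : (p : ℤ) ^ 3 ∣ n ^ 2 := by
    have : (p : ℤ) ^ 3 ∣ n ^ 2 * (-1) ^ (3 * k) := Dvd.intro_left c hc'
    exact (IsUnit.dvd_mul_right (isUnit_one.neg.pow _)).mp this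
  obtain ⟨b, rfl⟩ := hpZ.dvd_of_dvd_pow ((dvd_pow_self _ three_ne_zero).trans hd)
  have hd' : (p : ℤ) ∣ b ^ 2 := by
    rw [mul_pow, pow_succ (p : ℤ) 2] at hd
    exact Int.dvd_of_mul_dvd_mul_left (pow_ne_zero 2 hpZ.ne_zero) hd
  obtain ⟨d, rfl⟩ := hpZ.dvd_of_dvd_pow hd'
  exact ⟨d, by ring⟩

end Cyclotomic

end RotatedDn

end

theorem mainTheorem12 (p : ℕ) (hp : p.Prime) (hp3 : p ≡ 1 [MOD 3])
    {L : Type*} [Field L] [CharZero L] [IsCyclotomicExtension {p} ℚ L]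
    (ζ : L) (hζ : IsPrimitiveRoot ζ p)
    (r : ℕ) (hr : IsPrimitiveRoot (r : ZMod p) (p - 1))
    (σ : L ≃ₐ[ℚ] L) (hσ : σ ζ = ζ ^ r)
    (l : ℤ) (hl : l * ((r : ℤ) - 1) ≡ 1 [ZMOD (p : ℤ)]) :
    -- `K` is a totally real cubic field
    Module.finrank ℚ (RotatedDn.fixedK σ 3) = 3 ∧
    Nat.card (RotatedDn.fixedK σ 3 →+* ℝ) = 3 ∧
    -- the norm identity `N_K(x + σ(x)) = -N_K(x)`, with `x ≠ 0`
    RotatedDn.xElt 3 p r l ζ σ ≠ 0 ∧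
    Algebra.norm ℚ (RotatedDn.xElt 3 p r l ζ σ +
        RotatedDn.sigmaK σ 3 (RotatedDn.xElt 3 p r l ζ σ)) =
      -Algebra.norm ℚ (RotatedDn.xElt 3 p r l ζ σ) ∧
    -- for every ordering of the three real embeddings of `K`
    ∀ e : Fin 3 ≃ (RotatedDn.fixedK σ 3 →+* ℝ),
      RotatedDn.IsRotatedVersion (RotatedDn.latticeD 3 p r l ζ σ e) (RotatedDn.Dlat 3) ∧
      RotatedDn.HasMaximumDiversity (RotatedDn.latticeD 3 p r l ζ σ e) ∧
      (σ (RotatedDn.xElt 3 p r l ζ σ : L) / (RotatedDn.xElt 3 p r l ζ σ : L)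
          ∈ Algebra.adjoin ℤ ({ζ} : Set L) →
        RotatedDn.minProductDistance (RotatedDn.latticeD 3 p r l ζ σ e) = 1 / (p : ℝ)) := by
  open RotatedDn in
  obtain ⟨k, hk⟩ : ∃ k, p = 6 * k + 1 := by
    have h3 : p % 3 = 1 := hp3
    have h2 : p % 2 = 1 := by
      rcases hp.eq_two_or_odd with h | h
      · subst h
        norm_num at h3
      · exact h
    exact ⟨p / 6, by omega⟩
  have : NeZero p := ⟨hp.ne_zero⟩
  have := IsCyclotomicExtension.finiteDimensional {p} ℚ L
  have hK := finrank_fixedK_three (σ := σ) hp hk (orderOf_eq_sub_one hp hζ hr hσ)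
  obtain ⟨hP, hQ⟩ := orthogonal_conjugates_xElt hp hζ hr hσ hk hl rfl
  have hτ := sigmaK_three_cubed (σ := σ)
  obtain ⟨hx, h1, h2⟩ := ne_of_orthogonal_conjugates hp.ne_zero hτ hP hQ
  refine ⟨hK, ?_, hx, norm_add_conjugate hp.ne_zero hK hτ hP hQ, fun e => ⟨?_, ?_, fun hu => ?_⟩⟩
  -- Odd degree supplies one real embedding; composing it with the powers of τ gives all three.
  · have hfin : FiniteDimensional ℚ (fixedK σ 3) := inferInstance
    have : NumberField (fixedK σ 3) := @NumberField.mk _ _ inferInstance (by convert hfin)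
    obtain ⟨f⟩ := nonempty_real_embedding_of_odd_finrank (fixedK σ 3) (by
      have : Odd (Module.finrank ℚ (fixedK σ 3)) := by rw [hK]; decide
      convert this)
    rw [← Nat.card_congr (Equiv.ofBijective _ (bijective_comp_pow_real hK h1 h2 f))]
    simp
  · exact exists_rotation_of_orthogonal
      (conjugateMatrix_mem_orthogonalGroup hp.ne_zero hK hτ hP hQ e) (map_moduleM_eq_image e)
  · exact hasMaximumDiversity_map hp.ne_zero e _
  · have huL : IsIntegral ℤ (σ (xElt 3 p r l ζ σ : L) / (xElt 3 p r l ζ σ : L)) :=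
      (Algebra.adjoin_le (S := integralClosure ℤ L)
        (Set.singleton_subset_iff.mpr (hζ.isIntegral hp.pos))) hu
    have hu' : IsIntegral ℤ (sigmaK σ 3 (xElt 3 p r l ζ σ) / xElt 3 p r l ζ σ) := by
      rw [← isIntegral_algHom_iff ((fixedK σ 3).val.restrictScalars ℤ) Subtype.val_injective]
      exact huL
    have hux := (div_mul_cancel₀ (sigmaK σ 3 (xElt 3 p r l ζ σ)) hx).symm
    obtain ⟨n, hn, hdvd⟩ := exists_norm_xElt_eq hp hζ hr hσ hk hl
    exact minProductDistance_map_moduleM hp hK hτ hP hQ hu' hux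
      (abs_norm_eq_sq hp hK hτ hP hQ (e 0) hu' hux hn hdvd) e
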